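/- Let $0<n_1<n$, $n_0=n-n_1$, and let the $k$ covariates be partitioned into $T$ tiers of sizes $k_1,\dots,k_T$; row vectors are used throughout. Let $\boldsymbol{x}_1,\dots,\boldsymbol{x}_n$ be i.i.d. random vectors in $\mathbb{R}^k$, $\boldsymbol{x}_i=(\boldsymbol{x}_i^{(1)},\dots,\boldsymbol{x}_i^{(T)})$, with finite second moments and an ellipsoidal distribution: for some $\boldsymbol{\mu}\in\mathbb{R}^k$, some positive definite $\boldsymbol{\Sigma}$ and some function $\psi$, the characteristic function of $\boldsymbol{x}_i-\boldsymbol{\mu}$ is $\boldsymbol{h}\mapsto\psi(\boldsymbol{h}\boldsymbol{\Sigma}\boldsymbol{h}')$. Independently of the covariates, let $\boldsymbol{W}$ be uniformly distributed on $\mathcal{W}=\{\boldsymbol{w}\in\{0,1\}^n:\sum_i w_i=n_1\}$. Let $\boldsymbol{z}_i=(\boldsymbol{z}_i^{(1)},\dots,\boldsymbol{z}_i^{(T)})$ be obtained by block-wise Gram–Schmidt orthogonalization: $\boldsymbol{z}_i^{(t)}$ is the residual of the orthogonal projection in $L^2$ of $\boldsymbol{x}_i^{(t)}$ on $(1,\boldsymbol{x}_i^{(1)},\dots,\boldsymbol{x}_i^{(t-1)})$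 (with population coefficients, the same for all units). Let $\boldsymbol{z}$ be the matrix with rows $\boldsymbol{z}_i$ and $\boldsymbol{z}^{(t)}$ its block of columns of tier $t$. Let $\varphi(\boldsymbol{z},\boldsymbol{w})\in[0,1]$ be measurable in $\boldsymbol{z}$ and, for $\boldsymbol{w}\in\mathcal{W}$ and every $t$, invariant under every affine transformation of tier $t$ alone, that is, under replacing each row $\boldsymbol{z}_i^{(t)}$ by $\boldsymbol{z}_i^{(t)}A+\boldsymbol{b}$ with an invertible matrix $A$ and a vector $\boldsymbol{b}$ common to all $i$, with all other tiers unchanged. Let $\delta\in\{0,1\}$ be, given the covariates and $\boldsymbol{W}$, Bernoulli with success probability $\varphi(\boldsymbol{z},\boldsymbol{W})$, and suppose $\Pr(\delta=1)>0$ (the assignment is accepted when $\delta=1$). Write $\boldsymbol{D}^{(t)}=\overline{\boldsymbol{z}}_1^{(t)}-\overline{\boldsymbol{z}}_0^{(t)}=\frac1{n_1}\sum_{i:W_i=1}\boldsymbol{z}_i^{(t)}-\frac1{n_0}\sum_{i:W_i=0}\boldsymbol{z}_i^{(t)}$. Then, for every $t\in\{1,\dots,T\}$ and, in the formula for the cross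 moments, every $s\in\{1,\dots,T\}$ with $s\neq t$, the components of $\boldsymbol{D}^{(t)}$ are square integrable, both unconditionally and given $\delta=1$, and $$\mathbb{E}[\boldsymbol{D}^{(t)}\mid\delta=1]=\mathbb{E}[\boldsymbol{D}^{(t)}]=\boldsymbol{0},\qquad \mathbb{E}[(\boldsymbol{D}^{(s)})'\boldsymbol{D}^{(t)}\mid\delta=1]=\boldsymbol{0},$$ $$\operatorname{cov}(\boldsymbol{D}^{(t)}\mid\delta=1)=\nu_t\operatorname{cov}(\boldsymbol{D}^{(t)})\quad\text{for some constant }\nu_t\ge 0.$$ -/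

import Mathlib

open MeasureTheory ProbabilityTheory

noncomputable section

namespace Rerand

/-- A covariate vector in tiers: `v t` is the row vector of the `k t` covariates of tier `t`. -/
abbrev CovVec {T : ℕ} (k : Fin T → ℕ) : Type := (t : Fin T) → Fin (k t) → ℝ

/-- A covariate matrix in tiers: one covariate vector (row) for each of the `n` units. -/
abbrev CovMat (n : ℕ) {T : ℕ} (k : Fin T → ℕ) : Type := Fin n → CovVec k

/-- The index set of all the covariates: covariate `j` of tier `t` is `⟨t, j⟩`. -/
abbrev CovIdx {T : ℕ} (k : Fin T → ℕ) : Type := (t : Fin T) × Fin (k t)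

/-- The covariate vector with all its tiers put side by side, `(v 1, ..., v T)`. -/
def flatten {T : ℕ} {k : Fin T → ℕ} (v : CovVec k) : CovIdx k → ℝ := fun p => v p.1 p.2

/-- The law `ν` on `ℝ^ι` is ellipsoidal with parameters `m`, `S`, `ψ`: the matrix `S` is positive
semidefinite, and for `X` of law `ν` the characteristic function of `X - m` is
`h ↦ ψ (h S h')`. -/
def IsEllipsoidal {ι : Type*} [Fintype ι] (ν : Measure (ι → ℝ)) (m : ι → ℝ) (S : Matrix ι ι ℝ)
    (ψ : ℝ → ℂ) : Prop :=
  S.PosSemidef ∧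
    ∀ h : ι → ℝ, ∫ x, Complex.exp (((h ⬝ᵥ (x - m) : ℝ) : ℂ) * Complex.I) ∂ν
      = ψ (h ⬝ᵥ S.mulVec h)

/-- The block-wise affine map that subtracts from each tier an affine function of the preceding
tiers: tier `t` of the result is `x^(t) - a_t - ∑_{s < t} x^(s) B_{s,t}`. -/
def blockResidual {T : ℕ} {k : Fin T → ℕ} (a : CovVec k)
    (B : (s t : Fin T) → Matrix (Fin (k s)) (Fin (k t)) ℝ) (x : CovVec k) : CovVec k :=
  fun t => x t - a t - ∑ s ∈ Finset.univ.filter (fun s => s < t), Matrix.vecMul (x s) (B s t)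

/-- `a`, `B` are coefficients of the block-wise Gram-Schmidt orthogonalization of a random vector
of law `ν`: for each tier `t`, `(a_t, B_{s,t} (s < t))` are coefficients of the orthogonal
projection in `L²(ν)` of `x^(t)` on `(1, x^(1), ..., x^(t-1))`, that is, each component of the
residual is orthogonal to `1` and to all the components of `x^(1), ..., x^(t-1)`. -/
def IsGramSchmidt {T : ℕ} {k : Fin T → ℕ} (ν : Measure (CovVec k)) (a : CovVec k)
    (B : (s t : Fin T) → Matrix (Fin (k s)) (Fin (k t)) ℝ) : Prop :=
  ∀ (t : Fin T) (j : Fin (k t)),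
    ∫ x, blockResidual a B x t j ∂ν = 0 ∧
    ∀ s : Fin T, s < t → ∀ l : Fin (k s), ∫ x, x s l * blockResidual a B x t j ∂ν = 0

/-- The assignments of complete randomization: exactly `n₁` of the `n` units are treated. -/
def assignments (n n₁ : ℕ) : Set (Fin n → Bool) :=
  {w | (Finset.univ.filter (fun i => w i = true)).card = n₁}

/-- The affine transformation `z^(t) ↦ z^(t) A + b` of tier `t` of a covariate matrix (the same
for every row); all the other tiers are left unchanged. -/
def affineOnTier {n T : ℕ} {k : Fin T → ℕ} (t : Fin T) (A : Matrix (Fin (k t)) (Fin (k t)) ℝ)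
    (b : Fin (k t) → ℝ) (z : CovMat n k) : CovMat n k :=
  fun i => Function.update (z i) t (Matrix.vecMul (z i t) A + b)

/-- A stochastic balance criterion: measurable in the covariates, with values in `[0, 1]`. -/
def IsCriterion {n T : ℕ} {k : Fin T → ℕ} (n₁ : ℕ) (φ : CovMat n k → (Fin n → Bool) → ℝ) :
    Prop :=
  ∀ w ∈ assignments n n₁, Measurable (fun z => φ z w) ∧ ∀ z, φ z w ∈ Set.Icc (0 : ℝ) 1

/-- Affine invariance on each tier given the other ones. -/
def IsTierwiseAffineInvariant {n T : ℕ} {k : Fin T → ℕ} (n₁ : ℕ)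
    (φ : CovMat n k → (Fin n → Bool) → ℝ) : Prop :=
  ∀ (t : Fin T) (A : Matrix (Fin (k t)) (Fin (k t)) ℝ) (b : Fin (k t) → ℝ), IsUnit A →
    ∀ (z : CovMat n k), ∀ w ∈ assignments n n₁, φ (affineOnTier t A b z) w = φ z w

/-- The mean of the rows `z i` over the units in `s`. -/
def groupMean {n T : ℕ} {k : Fin T → ℕ} (z : CovMat n k) (s : Finset (Fin n)) : CovVec k :=
  fun t j => (∑ i ∈ s, z i t j) / (s.card : ℝ)

/-- The difference of the treatment and control group means of the covariates. -/
def diffMeans {n T : ℕ} {k : Fin T → ℕ} (z : CovMat n k) (w : Fin n → Bool) : CovVec k :=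
  groupMean z (Finset.univ.filter (fun i => w i = true))
    - groupMean z (Finset.univ.filter (fun i => w i = false))

/-- The covariance matrix of a random vector. -/
def covMatrix {Ω ι : Type*} [MeasurableSpace Ω] (P : Measure Ω) (D : Ω → ι → ℝ) :
    Matrix ι ι ℝ :=
  Matrix.of fun p q => covariance (fun ω => D ω p) (fun ω => D ω q) P

end Rerand

end

noncomputable section

namespace Rerand

/-! ### Linear functionals of an ellipsoidal law. -/

section Ellipsoidal

variable {ι : Type*} [Fintype ι] {μ : Measure (ι → ℝ)} {m : ι → ℝ} {S : Matrix ι ι ℝ} {ψ : ℝ → ℂ}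

/-! The argument is one of symmetry. Let `C` be the second-moment matrix of tier `t` of one residual
vector. Linear functionals of the residuals are centred functionals of an ellipsoidal vector, so
their laws are determined by their second moments. Since tiers are uncorrelated, a linear map of
tier `t` alone that preserves `C` preserves the second moment of every functional, hence the law of
the residuals (`map_tierMap_eq`).

Such a map, applied to all units, preserves the joint law of residuals and assignment, by
independence. If it is invertible it also preserves the acceptance probability, hence the law given
acceptance. The difference of means commutes with linear maps, so its law inherits the symmetry,
with and without conditioning (`IsTierInvariant`).

The map `-1` on tier `t` makes means and cross moments vanish. The reflections of the form `C` act
transitively on its level sets, up to null directions, so the second moment of a functional of tier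
`t` depends only on its value under `C`; by homogeneity the second-moment matrix is a multiple of
`C` (`IsTierInvariant.exists_tierGram_eq_smul`). Both covariance matrices are multiples of the same
`C`, hence proportional. No multiple has to be computed, and `C` may be singular. -/

theorem measurable_dotProduct_sub (h m : ι → ℝ) : Measurable fun x : ι → ℝ => h ⬝ᵥ (x - m) := by
  unfold dotProduct
  fun_prop

/-- The characteristic function of the functional `g` at `s` is `ψ (s ^ 2 * (g ⬝ᵥ S.mulVec g))`, so
it sees `g` only through the quadratic form. -/
theorem IsEllipsoidal.map_dotProduct_eq [IsProbabilityMeasure μ] (hμ : IsEllipsoidal μ m S ψ)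
    {h h' : ι → ℝ} (e : h ⬝ᵥ S.mulVec h = h' ⬝ᵥ S.mulVec h') :
    μ.map (fun x => h ⬝ᵥ (x - m)) = μ.map (fun x => h' ⬝ᵥ (x - m)) := by
  have key : ∀ (g : ι → ℝ) (s : ℝ), charFun (μ.map (fun x => g ⬝ᵥ (x - m))) s
      = ψ (s ^ 2 * (g ⬝ᵥ S.mulVec g)) := by
    intro g s
    rw [charFun_apply_real, integral_map (measurable_dotProduct_sub g m).aemeasurable
      (by fun_prop)]
    have := hμ.2 (s • g)
    rw [Matrix.mulVec_smul, smul_dotProduct, dotProduct_smul, smul_eq_mul, smul_eq_mul,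
      ← mul_assoc, ← sq] at this
    rw [← this]
    refine integral_congr_ae (Filter.Eventually.of_forall fun x => ?_)
    simp only [smul_dotProduct, smul_eq_mul, Complex.ofReal_mul]
  have := Measure.isProbabilityMeasure_map (μ := μ) (measurable_dotProduct_sub h m).aemeasurable
  have := Measure.isProbabilityMeasure_map (μ := μ) (measurable_dotProduct_sub h' m).aemeasurable
  refine Measure.ext_of_charFun (funext fun s => ?_)
  rw [key, key, e]

/-- The form takes the same value at `h` and `-h`, so the functional has a symmetric law. -/
theorem IsEllipsoidal.integral_dotProduct_eq_zero [IsProbabilityMeasure μ]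
    (hμ : IsEllipsoidal μ m S ψ) (h : ι → ℝ) : ∫ x, h ⬝ᵥ (x - m) ∂μ = 0 := by
  have e := hμ.map_dotProduct_eq (h := h) (h' := -h) (by simp [Matrix.mulVec_neg])
  have e' := congrArg (fun ρ : Measure ℝ => ∫ u, u ∂ρ) e
  beta_reduce at e'
  rw [integral_map (measurable_dotProduct_sub h m).aemeasurable (by fun_prop),
    integral_map (measurable_dotProduct_sub (-h) m).aemeasurable (by fun_prop)] at e'
  simp only [neg_dotProduct, integral_neg] at e'
  linarith

/-- In an ellipsoidal family, the law of a centred linear functional is determined by its second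
moment. -/
theorem IsEllipsoidal.map_dotProduct_eq_of_integral_sq_eq [IsProbabilityMeasure μ]
    (hμ : IsEllipsoidal μ m S ψ) {h h' : ι → ℝ}
    (hi : Integrable (fun x => (h ⬝ᵥ (x - m)) ^ 2) μ)
    (hi' : Integrable (fun x => (h' ⬝ᵥ (x - m)) ^ 2) μ)
    (e : ∫ x, (h ⬝ᵥ (x - m)) ^ 2 ∂μ = ∫ x, (h' ⬝ᵥ (x - m)) ^ 2 ∂μ) :
    μ.map (fun x => h ⬝ᵥ (x - m)) = μ.map (fun x => h' ⬝ᵥ (x - m)) := by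
  have hnn : ∀ g : ι → ℝ, 0 ≤ g ⬝ᵥ S.mulVec g := fun g => by
    simpa using hμ.1.dotProduct_mulVec_nonneg g
  wlog hlt : h ⬝ᵥ S.mulVec h < h' ⬝ᵥ S.mulVec h' generalizing h h'
  · rcases (not_lt.1 hlt).eq_or_lt with hq | hq
    · exact hμ.map_dotProduct_eq hq.symm
    · exact (this hi' hi e.symm hq).symm
  have hpos : 0 < h' ⬝ᵥ S.mulVec h' := (hnn h).trans_lt hlt
  -- The functional `h` has the law of `√r • h'`, so its second moment is `r` times that of `h'`.
  -- With `r < 1`, equal second moments must both be zero, and then both functionals vanish almost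
  -- everywhere.
  obtain ⟨r, hr⟩ : ∃ r, r = (h ⬝ᵥ S.mulVec h) / (h' ⬝ᵥ S.mulVec h') := ⟨_, rfl⟩
  have hr0 : 0 ≤ r := hr ▸ div_nonneg (hnn h) hpos.le
  have hr1 : r < 1 := hr ▸ (div_lt_one hpos).2 hlt
  have hs := Real.mul_self_sqrt hr0
  have e1 := hμ.map_dotProduct_eq (h := h) (h' := Real.sqrt r • h') (by
    rw [Matrix.mulVec_smul, smul_dotProduct, dotProduct_smul, smul_eq_mul, smul_eq_mul,
      ← mul_assoc, hs, hr, div_mul_cancel₀ _ hpos.ne'])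
  have e2 := congrArg (fun ρ : Measure ℝ => ∫ u, u ^ 2 ∂ρ) e1
  beta_reduce at e2
  rw [integral_map (measurable_dotProduct_sub h m).aemeasurable (by fun_prop),
    integral_map (measurable_dotProduct_sub _ m).aemeasurable (by fun_prop)] at e2
  simp only [smul_dotProduct, smul_eq_mul, mul_pow, integral_const_mul, sq (Real.sqrt r), hs] at e2
  have z' : ∫ x, (h' ⬝ᵥ (x - m)) ^ 2 ∂μ = 0 := by
    have : (1 - r) * ∫ x, (h' ⬝ᵥ (x - m)) ^ 2 ∂μ = 0 := by linarith
    exact (mul_eq_zero.1 this).resolve_left (by linarith)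
  rw [z'] at e
  rw [integral_eq_zero_iff_of_nonneg (fun x => sq_nonneg _) hi] at e
  rw [integral_eq_zero_iff_of_nonneg (fun x => sq_nonneg _) hi'] at z'
  refine Measure.map_congr ?_
  filter_upwards [e, z'] with x h1 h2
  simp only [Pi.zero_apply, pow_eq_zero_iff, ne_eq, OfNat.ofNat_ne_zero, not_false_eq_true]
    at h1 h2
  rw [h1, h2]

end Ellipsoidal

/-! ### Reflections of a symmetric bilinear form. -/

section Reflection

variable {ι : Type*} [Fintype ι] [DecidableEq ι]

/-- Vectors with the same value of a quadratic form are exchanged by a reflection that preserves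
the form. -/
theorem exists_isUnit_mulVec_eq {C : Matrix ι ι ℝ} (hC : C.transpose = C) {u v : ι → ℝ}
    (huv : u ⬝ᵥ C.mulVec u = v ⬝ᵥ C.mulVec v) (hd : (u - v) ⬝ᵥ C.mulVec (u - v) ≠ 0) :
    ∃ A : Matrix ι ι ℝ, IsUnit A ∧
      (∀ h, A.mulVec h ⬝ᵥ C.mulVec (A.mulVec h) = h ⬝ᵥ C.mulVec h) ∧ A.mulVec u = v := by
  have hsymm : ∀ x y : ι → ℝ, x ⬝ᵥ C.mulVec y = y ⬝ᵥ C.mulVec x := fun x y => by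
    rw [Matrix.dotProduct_mulVec, ← Matrix.mulVec_transpose, hC, dotProduct_comm]
  obtain ⟨d, rfl⟩ : ∃ d, v = u - d := ⟨u - v, by abel⟩
  rw [sub_sub_cancel] at hd
  -- The matrix `1 - Matrix.vecMulVec d w` is the `C`-orthogonal reflection along `d = u - v`. It is
  -- its own inverse because `w ⬝ᵥ d = 2`.
  obtain ⟨w, hw⟩ : ∃ w : ι → ℝ, w = (2 / (d ⬝ᵥ C.mulVec d)) • C.mulVec d := ⟨_, rfl⟩
  have hwh : ∀ h, w ⬝ᵥ h = 2 / (d ⬝ᵥ C.mulVec d) * (d ⬝ᵥ C.mulVec h) := fun h => by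
    rw [hw, smul_dotProduct, smul_eq_mul, dotProduct_comm (C.mulVec d), hsymm h d]
  have hwd : w ⬝ᵥ d = 2 := by rw [hwh, div_mul_cancel₀ _ hd]
  have hA : ∀ h, (1 - Matrix.vecMulVec d w).mulVec h = h - (w ⬝ᵥ h) • d := fun h => by
    rw [Matrix.sub_mulVec, Matrix.one_mulVec, Matrix.vecMulVec_mulVec]
    simp
  refine ⟨1 - Matrix.vecMulVec d w, ?_, fun h => ?_, ?_⟩
  · refine IsUnit.of_mul_eq_one (1 - Matrix.vecMulVec d w) ?_
    refine Matrix.toLin'.injective (LinearMap.ext fun h => ?_)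
    simp only [Matrix.toLin'_apply, ← Matrix.mulVec_mulVec, hA, Matrix.one_mulVec, dotProduct_sub,
      dotProduct_smul, hwd, smul_eq_mul]
    module
  · simp only [hA, Matrix.mulVec_sub, Matrix.mulVec_smul, dotProduct_sub, sub_dotProduct,
      dotProduct_smul, smul_dotProduct, smul_eq_mul, hwh]
    rw [hsymm h d]
    field_simp
    ring
  · rw [hA]
    -- Expanding the equality of the form at `u` and `u - d`; it says that the reflection subtracts
    -- exactly `d` from `u`.
    have : d ⬝ᵥ C.mulVec d = 2 * (d ⬝ᵥ C.mulVec u) := by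
      simp only [Matrix.mulVec_sub, dotProduct_sub, sub_dotProduct, hsymm u d] at huv
      linarith
    rw [hwh, this]
    have h0 : d ⬝ᵥ C.mulVec u ≠ 0 := fun h => hd (by rw [this, h, mul_zero])
    rw [show 2 / (2 * (d ⬝ᵥ C.mulVec u)) * (d ⬝ᵥ C.mulVec u) = 1 by field_simp, one_smul]

end Reflection

/-! ### Linear maps of a single tier and their invariant laws. -/

section TierMap

variable {T : ℕ} {k : Fin T → ℕ}

/-- The linear map `v^(t) ↦ v^(t) A` on tier `t`, the identity on the other tiers. -/
def tierMap (t : Fin T) (A : Matrix (Fin (k t)) (Fin (k t)) ℝ) : CovVec k →ₗ[ℝ] CovVec k where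
  toFun v := Function.update v t (Matrix.vecMul (v t) A)
  map_add' v w := by
    ext s l
    rcases eq_or_ne s t with rfl | h
    · simp [Matrix.add_vecMul]
    · simp [h]
  map_smul' c v := by
    ext s l
    rcases eq_or_ne s t with rfl | h
    · simp [Matrix.smul_vecMul]
    · simp [h]

@[simp]
theorem tierMap_same (t : Fin T) (A : Matrix (Fin (k t)) (Fin (k t)) ℝ) (v : CovVec k) :
    tierMap t A v t = Matrix.vecMul (v t) A := by
  simp [tierMap]

theorem tierMap_of_ne {s t : Fin T} (h : s ≠ t) (A : Matrix (Fin (k t)) (Fin (k t)) ℝ)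
    (v : CovVec k) : tierMap t A v s = v s := by
  simp [tierMap, h]

theorem affineOnTier_zero {n : ℕ} (t : Fin T) (A : Matrix (Fin (k t)) (Fin (k t)) ℝ)
    (z : CovMat n k) : affineOnTier t A 0 z = fun i => tierMap t A (z i) := by
  ext i : 1
  simp [affineOnTier, tierMap]

theorem exists_dotProduct_flatten (L : CovVec k →ₗ[ℝ] ℝ) :
    ∃ h : CovIdx k → ℝ, ∀ v, L v = h ⬝ᵥ flatten v := by
  let U : (CovIdx k → ℝ) →ₗ[ℝ] CovVec k :=
    { toFun := fun u t j => u ⟨t, j⟩, map_add' := fun _ _ => rfl, map_smul' := fun _ _ => rfl }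
  refine ⟨fun p => (L ∘ₗ U) (Pi.single p 1), fun v => ?_⟩
  have := LinearMap.pi_apply_eq_sum_univ (L ∘ₗ U) (flatten v)
  rw [dotProduct_comm]
  refine this.trans (Finset.sum_congr rfl fun p _ => ?_)
  have hp : (fun q => if p = q then 1 else 0) = (Pi.single p 1 : CovIdx k → ℝ) := by
    ext q
    simp [Pi.single_apply, eq_comm]
  rw [hp, smul_eq_mul]

theorem exists_tier_coefficients (L : CovVec k →ₗ[ℝ] ℝ) :
    ∃ g : (t : Fin T) → Fin (k t) → ℝ, ∀ v, L v = ∑ t, v t ⬝ᵥ g t := by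
  obtain ⟨h, hh⟩ := exists_dotProduct_flatten L
  refine ⟨fun t j => h ⟨t, j⟩, fun v => ?_⟩
  rw [hh, dotProduct, Fintype.sum_sigma]
  simp [dotProduct, flatten, mul_comm]

variable {μ : Measure (CovVec k)}

theorem memLp_dotProduct (hL2 : ∀ t (j : Fin (k t)), MemLp (fun v : CovVec k => v t j) 2 μ)
    (t : Fin T) (g : Fin (k t) → ℝ) : MemLp (fun v : CovVec k => v t ⬝ᵥ g) 2 μ := by
  unfold dotProduct
  exact memLp_finsetSum _ fun j _ => (hL2 t j).mul_const (g j)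

theorem integral_dotProduct_mul_dotProduct
    (hL2 : ∀ t (j : Fin (k t)), MemLp (fun v : CovVec k => v t j) 2 μ)
    (s t : Fin T) (g : Fin (k s) → ℝ) (h : Fin (k t) → ℝ) :
    ∫ v, (v s ⬝ᵥ g) * (v t ⬝ᵥ h) ∂μ
      = g ⬝ᵥ (Matrix.of fun l j => ∫ v, v s l * v t j ∂μ).mulVec h := by
  have hi : ∀ l j, Integrable (fun v : CovVec k => v s l * g l * (v t j * h j)) μ := fun l j =>
    ((hL2 s l).mul_const (g l)).integrable_mul ((hL2 t j).mul_const (h j))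
  have e : ∀ v : CovVec k, (v s ⬝ᵥ g) * (v t ⬝ᵥ h) = ∑ l, ∑ j, v s l * g l * (v t j * h j) :=
    fun v => by rw [dotProduct, dotProduct, Finset.sum_mul_sum]
  simp only [e]
  rw [integral_finsetSum _ fun l _ => integrable_finsetSum _ fun j _ => hi l j]
  simp only [dotProduct, Matrix.mulVec, Matrix.of_apply, Finset.mul_sum]
  refine Finset.sum_congr rfl fun l _ => ?_
  rw [integral_finsetSum _ fun j _ => hi l j]
  refine Finset.sum_congr rfl fun j _ => ?_
  rw [← mul_assoc, ← integral_const_mul, ← integral_mul_const]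
  congr 1
  ext v
  ring

/-- A law with uncorrelated tiers, in which the law of a linear functional is determined by its
second moment, is preserved by the linear maps of a single tier that preserve the second moments of
that tier. -/
theorem map_tierMap_eq [IsFiniteMeasure μ]
    (hL2 : ∀ t (j : Fin (k t)), MemLp (fun v : CovVec k => v t j) 2 μ)
    (hcross : ∀ s t, s ≠ t → ∀ (l : Fin (k s)) (j : Fin (k t)), ∫ v, v s l * v t j ∂μ = 0)
    (hlaw : ∀ L L' : CovVec k →ₗ[ℝ] ℝ, ∫ v, L v ^ 2 ∂μ = ∫ v, L' v ^ 2 ∂μ → μ.map L = μ.map L')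
    (t : Fin T) (A : Matrix (Fin (k t)) (Fin (k t)) ℝ)
    (hA : ∀ h, ∫ v, (v t ⬝ᵥ A.mulVec h) ^ 2 ∂μ = ∫ v, (v t ⬝ᵥ h) ^ 2 ∂μ) :
    MeasurePreserving (tierMap t A) μ μ := by
  have hmeas : Measurable (tierMap t A) :=
    (tierMap t A).continuous_of_finiteDimensional.measurable
  -- Cramér–Wold: it suffices to compare the laws of `L ∘ tierMap t A` and `L`, hence by `hlaw`
  -- their second moments.
  refine ⟨hmeas, Measure.ext_of_charFunDual (funext fun L => ?_)⟩
  rw [charFunDual_eq_charFun_map_one, charFunDual_eq_charFun_map_one,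
    Measure.map_map L.continuous.measurable hmeas]
  congr 1
  refine hlaw ((L : CovVec k →ₗ[ℝ] ℝ) ∘ₗ tierMap t A) L ?_
  obtain ⟨g, hg⟩ := exists_tier_coefficients (L : CovVec k →ₗ[ℝ] ℝ)
  have hsplit : ∀ v, (L : CovVec k →ₗ[ℝ] ℝ) v
      = v t ⬝ᵥ g t + ∑ s ∈ Finset.univ.erase t, v s ⬝ᵥ g s := fun v => by
    rw [hg, Finset.add_sum_erase _ (fun s => v s ⬝ᵥ g s) (Finset.mem_univ t)]
  have hsplit' : ∀ v, (L : CovVec k →ₗ[ℝ] ℝ) (tierMap t A v)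
      = v t ⬝ᵥ A.mulVec (g t) + ∑ s ∈ Finset.univ.erase t, v s ⬝ᵥ g s := fun v => by
    rw [hsplit, tierMap_same, Matrix.dotProduct_mulVec]
    congr 1
    refine Finset.sum_congr rfl fun s hs => ?_
    rw [tierMap_of_ne (Finset.ne_of_mem_erase hs)]
  have hR : MemLp (fun v : CovVec k => ∑ s ∈ Finset.univ.erase t, v s ⬝ᵥ g s) 2 μ :=
    memLp_finsetSum _ fun s _ => memLp_dotProduct hL2 s (g s)
  -- Pythagoras: tier `t` is orthogonal to the rest, so only its own second moment is affected by
  -- `A`.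
  have hpyth : ∀ h : Fin (k t) → ℝ,
      ∫ v, (v t ⬝ᵥ h + ∑ s ∈ Finset.univ.erase t, v s ⬝ᵥ g s) ^ 2 ∂μ
        = ∫ v, (v t ⬝ᵥ h) ^ 2 ∂μ + ∫ v, (∑ s ∈ Finset.univ.erase t, v s ⬝ᵥ g s) ^ 2 ∂μ := by
    intro h
    have hV := memLp_dotProduct hL2 t h
    have h0 : ∫ v, (v t ⬝ᵥ h) * (∑ s ∈ Finset.univ.erase t, v s ⬝ᵥ g s) ∂μ = 0 := by
      simp only [Finset.mul_sum]
      have hi : ∀ s, Integrable (fun v : CovVec k => (v t ⬝ᵥ h) * (v s ⬝ᵥ g s)) μ := fun s =>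
        hV.integrable_mul (memLp_dotProduct hL2 s (g s))
      rw [integral_finsetSum _ fun s _ => hi s]
      refine Finset.sum_eq_zero fun s hs => ?_
      rw [integral_dotProduct_mul_dotProduct hL2]
      have : (Matrix.of fun l j => ∫ v, v t l * v s j ∂μ) = 0 := by
        ext l j
        exact hcross t s (Finset.ne_of_mem_erase hs).symm l j
      rw [this, Matrix.zero_mulVec, dotProduct_zero]
    have e : ∀ v : CovVec k, (v t ⬝ᵥ h + ∑ s ∈ Finset.univ.erase t, v s ⬝ᵥ g s) ^ 2
        = (v t ⬝ᵥ h) ^ 2 + (∑ s ∈ Finset.univ.erase t, v s ⬝ᵥ g s) ^ 2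
          + 2 * ((v t ⬝ᵥ h) * (∑ s ∈ Finset.univ.erase t, v s ⬝ᵥ g s)) := fun v => by ring
    simp only [e]
    have hVR : Integrable (fun v : CovVec k =>
        2 * ((v t ⬝ᵥ h) * (∑ s ∈ Finset.univ.erase t, v s ⬝ᵥ g s))) μ :=
      (hV.integrable_mul hR).const_mul 2
    have hVV : Integrable (fun v : CovVec k =>
        (v t ⬝ᵥ h) ^ 2 + (∑ s ∈ Finset.univ.erase t, v s ⬝ᵥ g s) ^ 2) μ :=
      hV.integrable_sq.add hR.integrable_sq
    rw [integral_add hVV hVR, integral_add hV.integrable_sq hR.integrable_sq, integral_const_mul, h0]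
    ring
  have hl : ∀ v, ((L : CovVec k →ₗ[ℝ] ℝ) ∘ₗ tierMap t A) v
      = v t ⬝ᵥ A.mulVec (g t) + ∑ s ∈ Finset.univ.erase t, v s ⬝ᵥ g s := hsplit'
  simp only [hl]
  simp only [hsplit, hpyth, hA]

end TierMap

/-! ### The law of the block-wise residuals. -/

section GramSchmidt

variable {T : ℕ} {k : Fin T → ℕ} {ν : Measure (CovVec k)}
  {a : CovVec k} {B : (s t : Fin T) → Matrix (Fin (k s)) (Fin (k t)) ℝ}

theorem measurable_flatten : Measurable (flatten : CovVec k → CovIdx k → ℝ) := by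
  unfold flatten
  fun_prop

/-- The linear part of the block-wise residual map. -/
def residualLinear (B : (s t : Fin T) → Matrix (Fin (k s)) (Fin (k t)) ℝ) :
    CovVec k →ₗ[ℝ] CovVec k :=
  LinearMap.pi fun t => LinearMap.proj t
    - ∑ s ∈ Finset.univ.filter (fun s => s < t), (Matrix.vecMulLinear (B s t)) ∘ₗ LinearMap.proj s

theorem blockResidual_eq (a : CovVec k) (B : (s t : Fin T) → Matrix (Fin (k s)) (Fin (k t)) ℝ)
    (x : CovVec k) : blockResidual a B x = residualLinear B x - a := by
  ext t j
  simp [blockResidual, residualLinear]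
  ring

theorem measurable_blockResidual : Measurable (blockResidual (k := k) a B) := by
  have : blockResidual a B = fun x => residualLinear B x - a := funext (blockResidual_eq a B)
  rw [this]
  exact ((residualLinear B).continuous_of_finiteDimensional.sub continuous_const).measurable

theorem memLp_blockResidual [IsFiniteMeasure ν]
    (hν2 : ∀ t (j : Fin (k t)), MemLp (fun v : CovVec k => v t j) 2 ν)
    (t : Fin T) (j : Fin (k t)) : MemLp (fun v => blockResidual a B v t j) 2 ν := by
  obtain ⟨g, hg⟩ := exists_tier_coefficients
    ((LinearMap.proj j ∘ₗ LinearMap.proj t : CovVec k →ₗ[ℝ] ℝ) ∘ₗ residualLinear B)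
  have : (fun v => blockResidual a B v t j) = fun v => (∑ t, v t ⬝ᵥ g t) - a t j := by
    ext v
    rw [blockResidual_eq, ← hg]
    rfl
  rw [this]
  exact (memLp_finsetSum _ fun s _ => memLp_dotProduct hν2 s (g s)).sub (memLp_const _)

/-- For `s < t`, the residual of tier `s` is an affine function of the tiers up to `s`, all
orthogonal to the residual of tier `t`. -/
theorem IsGramSchmidt.integral_mul_eq_zero [IsFiniteMeasure ν] (hGS : IsGramSchmidt ν a B)
    (hν2 : ∀ t (j : Fin (k t)), MemLp (fun v : CovVec k => v t j) 2 ν) {s t : Fin T} (hst : s ≠ t)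
    (l : Fin (k s)) (j : Fin (k t)) :
    ∫ v, blockResidual a B v s l * blockResidual a B v t j ∂ν = 0 := by
  wlog h : s < t generalizing s t
  · have := this hst.symm j l (lt_of_le_of_ne (not_lt.1 h) hst.symm)
    simpa only [mul_comm] using this
  have hz := memLp_blockResidual (a := a) (B := B) hν2 t j
  have e : ∀ v : CovVec k, blockResidual a B v s l * blockResidual a B v t j
      = v s l * blockResidual a B v t j - a s l * blockResidual a B v t j
        - ∑ r ∈ Finset.univ.filter (fun r => r < s), ∑ i,
            B r s i l * (v r i * blockResidual a B v t j) := by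
    intro v
    conv_lhs => rw [blockResidual]
    simp only [Pi.sub_apply, Finset.sum_apply, Matrix.vecMul, dotProduct, sub_mul, Finset.sum_mul]
    congr 1
    refine Finset.sum_congr rfl fun r _ => Finset.sum_congr rfl fun i _ => by ring
  have hi : ∀ r (i : Fin (k r)), Integrable (fun v => v r i * blockResidual a B v t j) ν :=
    fun r i => (hν2 r i).integrable_mul hz
  have hz1 : Integrable (fun v => blockResidual a B v t j) ν := hz.integrable (by norm_num)
  simp only [e]
  have hd : Integrable (fun v => v s l * blockResidual a B v t j
      - a s l * blockResidual a B v t j) ν := (hi s l).sub (hz1.const_mul _)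
  rw [integral_sub hd
      (integrable_finsetSum _ fun r _ => integrable_finsetSum _ fun i _ => (hi r i).const_mul _),
    integral_sub (hi s l) (hz1.const_mul _), integral_const_mul, (hGS t j).1, (hGS t j).2 s h l,
    integral_finsetSum _ fun r _ => integrable_finsetSum _ fun i _ => (hi r i).const_mul _,
    Finset.sum_eq_zero, mul_zero, sub_zero, sub_zero]
  intro r hr
  rw [integral_finsetSum _ fun i _ => (hi r i).const_mul _]
  refine Finset.sum_eq_zero fun i _ => ?_
  rw [integral_const_mul, (hGS t j).2 r ((Finset.mem_filter.1 hr).2.trans h) i, mul_zero]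

/-- The two sides differ by a constant, and both are centred: the left by orthogonality of the
residuals to `1`, the right by the symmetry of the ellipsoidal law. -/
theorem exists_functional_blockResidual_eq [IsProbabilityMeasure ν] (hGS : IsGramSchmidt ν a B)
    (hν2 : ∀ t (j : Fin (k t)), MemLp (fun v : CovVec k => v t j) 2 ν)
    {m : CovIdx k → ℝ} {S : Matrix (CovIdx k) (CovIdx k) ℝ} {ψ : ℝ → ℂ}
    (hν : IsEllipsoidal (ν.map flatten) m S ψ) (L : CovVec k →ₗ[ℝ] ℝ) :
    ∃ h : CovIdx k → ℝ, ∀ v, L (blockResidual a B v) = h ⬝ᵥ (flatten v - m) := by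
  have := Measure.isProbabilityMeasure_map (μ := ν) measurable_flatten.aemeasurable
  obtain ⟨h, hh⟩ := exists_dotProduct_flatten (L ∘ₗ residualLinear B)
  have e : ∀ v, L (blockResidual a B v) = h ⬝ᵥ (flatten v - m) + (h ⬝ᵥ m - L a) := fun v => by
    rw [blockResidual_eq, map_sub, dotProduct_sub, ← hh]
    simp
  have h0 : ∫ v, h ⬝ᵥ (flatten v - m) ∂ν = 0 := by
    have := hν.integral_dotProduct_eq_zero h
    rwa [integral_map measurable_flatten.aemeasurable
      (measurable_dotProduct_sub h m).aestronglyMeasurable] at this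
  obtain ⟨g, hg⟩ := exists_tier_coefficients L
  have hz1 : ∀ t (j : Fin (k t)), Integrable (fun v => blockResidual a B v t j * g t j) ν :=
    fun t j => ((memLp_blockResidual hν2 t j).integrable (by norm_num)).mul_const _
  have hzi : Integrable (fun v => L (blockResidual a B v)) ν := by
    simp only [hg, dotProduct]
    exact integrable_finsetSum _ fun t _ => integrable_finsetSum _ fun j _ => hz1 t j
  have hz0 : ∫ v, L (blockResidual a B v) ∂ν = 0 := by
    simp only [hg, dotProduct]
    rw [integral_finsetSum _ fun t _ => integrable_finsetSum _ fun j _ => hz1 t j]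
    refine Finset.sum_eq_zero fun t _ => ?_
    rw [integral_finsetSum _ fun j _ => hz1 t j]
    refine Finset.sum_eq_zero fun j _ => ?_
    rw [integral_mul_const, (hGS t j).1, zero_mul]
  have hint : Integrable (fun v => h ⬝ᵥ (flatten v - m)) ν := by
    refine (hzi.sub (integrable_const (h ⬝ᵥ m - L a))).congr (Filter.Eventually.of_forall fun v => ?_)
    simp [e]
  simp only [e] at hz0
  rw [integral_add hint (integrable_const _), h0] at hz0
  have hc : h ⬝ᵥ m - L a = 0 := by simpa using hz0
  exact ⟨h, fun v => by rw [e, hc, add_zero]⟩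

theorem map_functional_eq [IsProbabilityMeasure ν] (hGS : IsGramSchmidt ν a B)
    (hν2 : ∀ t (j : Fin (k t)), MemLp (fun v : CovVec k => v t j) 2 ν)
    {m : CovIdx k → ℝ} {S : Matrix (CovIdx k) (CovIdx k) ℝ} {ψ : ℝ → ℂ}
    (hν : IsEllipsoidal (ν.map flatten) m S ψ) (L L' : CovVec k →ₗ[ℝ] ℝ)
    (e : ∫ v, L (blockResidual a B v) ^ 2 ∂ν = ∫ v, L' (blockResidual a B v) ^ 2 ∂ν) :
    ν.map (fun v => L (blockResidual a B v)) = ν.map (fun v => L' (blockResidual a B v)) := by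
  have := Measure.isProbabilityMeasure_map (μ := ν) measurable_flatten.aemeasurable
  have hL2 : ∀ L : CovVec k →ₗ[ℝ] ℝ, Integrable (fun v => L (blockResidual a B v) ^ 2) ν := by
    intro L
    obtain ⟨g, hg⟩ := exists_tier_coefficients L
    simp only [hg, dotProduct]
    exact (memLp_finsetSum _ fun t _ => memLp_finsetSum _ fun j _ =>
      (memLp_blockResidual hν2 t j).mul_const (g t j)).integrable_sq
  have hi := hL2 L
  have hi' := hL2 L'
  obtain ⟨h, hh⟩ := exists_functional_blockResidual_eq hGS hν2 hν L
  obtain ⟨h', hh'⟩ := exists_functional_blockResidual_eq hGS hν2 hν L'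
  simp only [hh, hh'] at hi hi' e ⊢
  have hm := fun g : CovIdx k → ℝ => measurable_dotProduct_sub g m
  have hm2 := fun g : CovIdx k → ℝ => ((hm g).pow_const 2).aestronglyMeasurable (μ := ν.map flatten)
  have key := hν.map_dotProduct_eq_of_integral_sq_eq (h := h) (h' := h')
    ((integrable_map_measure (hm2 h) measurable_flatten.aemeasurable).2 hi)
    ((integrable_map_measure (hm2 h') measurable_flatten.aemeasurable).2 hi')
    (by rwa [integral_map measurable_flatten.aemeasurable (hm2 h),
          integral_map measurable_flatten.aemeasurable (hm2 h')])
  rwa [Measure.map_map (hm h) measurable_flatten, Measure.map_map (hm h') measurable_flatten] at key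

/-- The law of the block-wise residuals is preserved by the linear maps of a single tier that
preserve the second moments of that tier. -/
theorem IsGramSchmidt.measurePreserving_tierMap [IsProbabilityMeasure ν]
    (hGS : IsGramSchmidt ν a B)
    (hν2 : ∀ t (j : Fin (k t)), MemLp (fun v : CovVec k => v t j) 2 ν)
    {m : CovIdx k → ℝ} {S : Matrix (CovIdx k) (CovIdx k) ℝ} {ψ : ℝ → ℂ}
    (hν : IsEllipsoidal (ν.map flatten) m S ψ)
    (t : Fin T) (A : Matrix (Fin (k t)) (Fin (k t)) ℝ)
    (hA : ∀ h, A.mulVec h ⬝ᵥ (Matrix.of fun l j => ∫ v, v t l * v t j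
        ∂(ν.map (blockResidual a B))).mulVec (A.mulVec h)
      = h ⬝ᵥ (Matrix.of fun l j => ∫ v, v t l * v t j ∂(ν.map (blockResidual a B))).mulVec h) :
    MeasurePreserving (tierMap t A) (ν.map (blockResidual a B)) (ν.map (blockResidual a B)) := by
  have hZ : Measurable (blockResidual a B) := measurable_blockResidual
  have hc : ∀ t (j : Fin (k t)), Measurable fun v : CovVec k => v t j := fun t j => by fun_prop
  have hL2 : ∀ t (j : Fin (k t)), MemLp (fun v : CovVec k => v t j) 2 (ν.map (blockResidual a B)) :=
    fun t j => (memLp_map_measure_iff (hc t j).aestronglyMeasurable hZ.aemeasurable).2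
      (memLp_blockResidual hν2 t j)
  refine map_tierMap_eq hL2 (fun s t hst l j => ?_) (fun L L' e => ?_) t A fun h => ?_
  · have hst' : Measurable fun v : CovVec k => v s l * v t j := (hc s l).mul (hc t j)
    rw [integral_map hZ.aemeasurable hst'.aestronglyMeasurable]
    exact hGS.integral_mul_eq_zero hν2 hst l j
  · have hL : ∀ L : CovVec k →ₗ[ℝ] ℝ, Measurable L := fun L =>
      L.continuous_of_finiteDimensional.measurable
    rw [integral_map hZ.aemeasurable ((hL L).pow_const 2).aestronglyMeasurable,
      integral_map hZ.aemeasurable ((hL L').pow_const 2).aestronglyMeasurable] at e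
    rw [Measure.map_map (hL L) hZ, Measure.map_map (hL L') hZ]
    exact map_functional_eq hGS hν2 hν L L' e
  · simp only [sq]
    rw [integral_dotProduct_mul_dotProduct hL2, integral_dotProduct_mul_dotProduct hL2, hA]

end GramSchmidt

/-! ### Moments of a law with tier symmetries. -/

section TierInvariantLaw

/-- Polarization. -/
theorem matrix_eq_of_forall_dotProduct_mulVec {ι : Type*} [Fintype ι] [DecidableEq ι]
    {M N : Matrix ι ι ℝ} (hM : M.transpose = M) (hN : N.transpose = N)
    (h : ∀ v, v ⬝ᵥ M.mulVec v = v ⬝ᵥ N.mulVec v) : M = N := by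
  ext p q
  have h1 := h (Pi.single p 1 + Pi.single q 1)
  have h2 := h (Pi.single p 1)
  have h3 := h (Pi.single q 1)
  have h4 : M q p = M p q := congrFun (congrFun hM p) q
  have h5 : N q p = N p q := congrFun (congrFun hN p) q
  simp only [Matrix.mulVec_add, dotProduct_add, add_dotProduct, Matrix.mulVec_single_one,
    single_one_dotProduct, Matrix.col_apply] at h1 h2 h3
  linarith

variable {T : ℕ} {k : Fin T → ℕ} {μ : Measure (CovVec k)} {t : Fin T}

/-- The second moments of a tier. -/
def tierGram (μ : Measure (CovVec k)) (t : Fin T) : Matrix (Fin (k t)) (Fin (k t)) ℝ :=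
  Matrix.of fun l j => ∫ v, v t l * v t j ∂μ

theorem tierGram_transpose (μ : Measure (CovVec k)) (t : Fin T) :
    (tierGram μ t).transpose = tierGram μ t := by
  ext l j
  simp [tierGram, mul_comm]

theorem integral_sq_dotProduct
    (hL2 : ∀ t (j : Fin (k t)), MemLp (fun v : CovVec k => v t j) 2 μ)
    (h : Fin (k t) → ℝ) : ∫ v, (v t ⬝ᵥ h) ^ 2 ∂μ = h ⬝ᵥ (tierGram μ t).mulVec h := by
  simp only [sq]
  exact integral_dotProduct_mul_dotProduct hL2 t t h h

theorem ae_dotProduct_eq_zero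
    (hL2 : ∀ t (j : Fin (k t)), MemLp (fun v : CovVec k => v t j) 2 μ)
    {h : Fin (k t) → ℝ} (h0 : h ⬝ᵥ (tierGram μ t).mulVec h = 0) : ∀ᵐ v ∂μ, v t ⬝ᵥ h = 0 := by
  rw [← integral_sq_dotProduct hL2, integral_eq_zero_iff_of_nonneg (fun _ => sq_nonneg _)
    (memLp_dotProduct hL2 t h).integrable_sq] at h0
  filter_upwards [h0] with v hv
  simpa using hv

/-- The measure `μ` is invariant under the linear maps of tier `t` that preserve the quadratic form
of `C`. -/
def IsTierInvariant (μ : Measure (CovVec k)) (t : Fin T) (C : Matrix (Fin (k t)) (Fin (k t)) ℝ) :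
    Prop :=
  ∀ A : Matrix (Fin (k t)) (Fin (k t)) ℝ, IsUnit A →
    (∀ h, A.mulVec h ⬝ᵥ C.mulVec (A.mulVec h) = h ⬝ᵥ C.mulVec h) →
    MeasurePreserving (tierMap t A) μ μ

variable {C : Matrix (Fin (k t)) (Fin (k t)) ℝ}

/-- The matrix `-1` preserves every quadratic form; this sign change alone gives the first moments
and the cross moments. -/
theorem IsTierInvariant.map_neg (hμ : IsTierInvariant μ t C) :
    MeasurePreserving (tierMap t (-1)) μ μ :=
  hμ _ isUnit_one.neg fun h => by simp [Matrix.neg_mulVec, Matrix.mulVec_neg]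

theorem IsTierInvariant.integral_eq_zero (hμ : IsTierInvariant μ t C) (j : Fin (k t)) :
    ∫ v, v t j ∂μ = 0 := by
  have hm : Measurable fun v : CovVec k => v t j := by fun_prop
  have h := hμ.map_neg
  have e : ∫ v, v t j ∂μ = ∫ v, tierMap t (-1) v t j ∂μ := by
    conv_lhs => rw [← h.map_eq]
    exact integral_map h.measurable.aemeasurable hm.aestronglyMeasurable
  simp only [tierMap_same, Matrix.vecMul_neg, Matrix.vecMul_one, Pi.neg_apply, integral_neg] at e
  linarith

theorem IsTierInvariant.integral_mul_eq_zero (hμ : IsTierInvariant μ t C) {s : Fin T} (hst : s ≠ t)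
    (l : Fin (k s)) (j : Fin (k t)) : ∫ v, v s l * v t j ∂μ = 0 := by
  have hm : Measurable fun v : CovVec k => v s l * v t j := by fun_prop
  have h := hμ.map_neg
  have e : ∫ v, v s l * v t j ∂μ = ∫ v, tierMap t (-1) v s l * tierMap t (-1) v t j ∂μ := by
    conv_lhs => rw [← h.map_eq]
    exact integral_map h.measurable.aemeasurable hm.aestronglyMeasurable
  simp only [tierMap_same, tierMap_of_ne hst, Matrix.vecMul_neg, Matrix.vecMul_one, Pi.neg_apply,
    mul_neg, integral_neg] at e
  linarith

/-- The second moments of an invariant tier are proportional to the invariant form. -/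
theorem IsTierInvariant.exists_tierGram_eq_smul (hμ : IsTierInvariant μ t C)
    (hL2 : ∀ t (j : Fin (k t)), MemLp (fun v : CovVec k => v t j) 2 μ)
    (hC : C.transpose = C) (hpos : ∀ h, 0 ≤ h ⬝ᵥ C.mulVec h)
    (hdeg : ∀ d, d ⬝ᵥ C.mulVec d = 0 → ∀ᵐ v ∂μ, v t ⬝ᵥ d = 0) :
    ∃ κ : ℝ, 0 ≤ κ ∧ tierGram μ t = κ • C := by
  have key : ∀ u w, u ⬝ᵥ C.mulVec u = w ⬝ᵥ C.mulVec w →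
      ∫ v, (v t ⬝ᵥ u) ^ 2 ∂μ = ∫ v, (v t ⬝ᵥ w) ^ 2 ∂μ := by
    intro u w huw
    -- If `u - w` is a null direction no reflection is available, but the two functionals agree
    -- almost everywhere.
    by_cases hd : (u - w) ⬝ᵥ C.mulVec (u - w) = 0
    · refine integral_congr_ae ?_
      filter_upwards [hdeg _ hd] with v hv
      rw [dotProduct_sub, sub_eq_zero] at hv
      rw [hv]
    · obtain ⟨A, hA, hAC, rfl⟩ := exists_isUnit_mulVec_eq hC huw hd
      have h := hμ A hA hAC
      have hm : Measurable fun v : CovVec k => (v t ⬝ᵥ u) ^ 2 := by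
        unfold dotProduct
        fun_prop
      have e : ∫ v, (v t ⬝ᵥ u) ^ 2 ∂μ = ∫ v, (tierMap t A v t ⬝ᵥ u) ^ 2 ∂μ := by
        conv_lhs => rw [← h.map_eq]
        exact integral_map h.measurable.aemeasurable hm.aestronglyMeasurable
      rw [e]
      simp only [tierMap_same, Matrix.dotProduct_mulVec]
  have hform : ∀ κ : ℝ, (∀ h, ∫ v, (v t ⬝ᵥ h) ^ 2 ∂μ = κ * (h ⬝ᵥ C.mulVec h)) →
      tierGram μ t = κ • C := fun κ hκ =>
    matrix_eq_of_forall_dotProduct_mulVec (tierGram_transpose μ t)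
      (by rw [Matrix.transpose_smul, hC]) fun h => by
        rw [← integral_sq_dotProduct hL2, hκ, Matrix.smul_mulVec, dotProduct_smul, smul_eq_mul]
  by_cases h0 : ∃ u, u ⬝ᵥ C.mulVec u ≠ 0
  · obtain ⟨u, hu⟩ := h0
    refine ⟨(∫ v, (v t ⬝ᵥ u) ^ 2 ∂μ) / (u ⬝ᵥ C.mulVec u),
      div_nonneg (integral_nonneg fun _ => sq_nonneg _) (hpos u), hform _ fun h => ?_⟩
    have hr := Real.mul_self_sqrt (div_nonneg (hpos h) (hpos u))
    -- Rescale the reference vector `u` to the level set of `h`; both sides are quadratic in the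
    -- scale.
    rw [key h (Real.sqrt ((h ⬝ᵥ C.mulVec h) / (u ⬝ᵥ C.mulVec u)) • u)]
    · simp only [dotProduct_smul, smul_eq_mul, mul_pow, integral_const_mul]
      rw [sq, hr]
      ring
    · rw [Matrix.mulVec_smul, smul_dotProduct, dotProduct_smul, smul_eq_mul, smul_eq_mul,
        ← mul_assoc, hr, div_mul_cancel₀ _ hu]
  · push Not at h0
    refine ⟨0, le_rfl, hform 0 fun h => ?_⟩
    rw [key h 0 (by simp [h0 h])]
    simp

end TierInvariantLaw

/-! ### Conditioning on acceptance as a change of density. -/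

section Acceptance

variable {Ω α : Type*} [MeasurableSpace α]

theorem measurePreserving_withDensity {ρ : Measure α} {g : α → α} (hg : MeasurePreserving g ρ ρ)
    {f : α → ENNReal} (hf : Measurable f) (hfg : ∀ x, f (g x) = f x) :
    MeasurePreserving g (ρ.withDensity f) (ρ.withDensity f) := by
  refine ⟨hg.measurable, Measure.ext fun s hs => ?_⟩
  rw [Measure.map_apply hg.measurable hs, withDensity_apply _ (hg.measurable hs),
    withDensity_apply _ hs, ← hg.setLIntegral_comp_preimage hs hf]
  simp only [hfg]

/-- The law of `η` on an event is the law of `η` weighted by the conditional probability of the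
event, when this is a function of `η`. -/
theorem map_restrict_eq_withDensity {𝓕 𝓜 : MeasurableSpace Ω} {P : Measure Ω}
    [IsProbabilityMeasure P] (h𝓕 : 𝓕 ≤ 𝓜) {E : Set Ω} (hE : MeasurableSet E)
    {η : Ω → α} (hη : Measurable[𝓕] η) {f : α → ℝ} (hf : Measurable f) (hf0 : ∀ x, 0 ≤ f x)
    (h : P⟦E | 𝓕⟧ =ᵐ[P] fun ω => f (η ω)) :
    (P.restrict E).map η = (P.map η).withDensity fun x => ENNReal.ofReal (f x) := by
  have hη' : Measurable η := hη.mono h𝓕 le_rfl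
  ext G hG
  have hG' : MeasurableSet[𝓕] (η ⁻¹' G) := hη hG
  have hG'' : MeasurableSet (η ⁻¹' G) := hη' hG
  have hint : Integrable (fun ω => f (η ω)) P := integrable_condExp.congr h
  rw [Measure.map_apply hη' hG, Measure.restrict_apply hG'', withDensity_apply _ hG,
    setLIntegral_map hG hf.ennreal_ofReal hη',
    ← ofReal_integral_eq_lintegral_ofReal hint.integrableOn
      (Filter.Eventually.of_forall fun ω => hf0 _)]
  have e1 : ∫ ω in η ⁻¹' G, f (η ω) ∂P = ∫ ω in η ⁻¹' G, (P⟦E | 𝓕⟧) ω ∂P :=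
    setIntegral_congr_ae hG'' (h.mono fun ω hω _ => hω.symm)
  rw [e1, setIntegral_condExp h𝓕 ((integrable_const (1 : ℝ)).indicator hE) hG',
    setIntegral_indicator hE]
  simp

end Acceptance

/-! ### The sample, the assignment and the difference of means. -/

section Sampling

variable {Ω : Type*} [MeasurableSpace Ω] {n T : ℕ} {k : Fin T → ℕ}

/-- The weights of the units in the difference of group means. -/
def groupWeight (w : Fin n → Bool) (i : Fin n) : ℝ :=
  if w i = true then ((Finset.univ.filter fun i => w i = true).card : ℝ)⁻¹
  else -((Finset.univ.filter fun i => w i = false).card : ℝ)⁻¹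

/-- A bound uniform in `w` dominates the difference of means by a sum over all units, whatever the
random assignment. An empty group is harmless because `0⁻¹ = 0`. -/
theorem abs_groupWeight_le_one (w : Fin n → Bool) (i : Fin n) : |groupWeight w i| ≤ 1 := by
  have h : ∀ m : ℕ, |(m : ℝ)⁻¹| ≤ 1 := fun m => by
    rw [abs_of_nonneg (by positivity)]
    exact Nat.cast_inv_le_one m
  unfold groupWeight
  split_ifs
  · exact h _
  · rw [abs_neg]
    exact h _

theorem diffMeans_eq_sum (z : CovMat n k) (w : Fin n → Bool) :
    diffMeans z w = ∑ i, groupWeight w i • z i := by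
  ext t j
  simp only [diffMeans, groupMean, Pi.sub_apply, Finset.sum_apply, Pi.smul_apply, smul_eq_mul,
    div_eq_inv_mul, Finset.mul_sum, Finset.sum_filter]
  rw [← Finset.sum_sub_distrib]
  refine Finset.sum_congr rfl fun i _ => ?_
  unfold groupWeight
  cases h : w i <;> simp

theorem diffMeans_map (L : CovVec k →ₗ[ℝ] CovVec k) (z : CovMat n k) (w : Fin n → Bool) :
    diffMeans (fun i => L (z i)) w = L (diffMeans z w) := by
  rw [diffMeans_eq_sum, diffMeans_eq_sum, map_sum]
  simp only [map_smul]

theorem measurable_diffMeans :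
    Measurable fun p : CovMat n k × (Fin n → Bool) => diffMeans p.1 p.2 := by
  refine measurable_from_prod_countable_left fun w => ?_
  simp only [diffMeans_eq_sum]
  fun_prop

variable {P : Measure Ω} {z : Ω → CovMat n k} {W : Ω → Fin n → Bool}

theorem measurable_diffMeans_comp (hz : Measurable z) (hW : Measurable W) :
    Measurable fun ω => diffMeans (z ω) (W ω) := by
  have h := (measurable_diffMeans (n := n) (k := k)).comp (hz.prodMk hW)
  exact h

theorem memLp_diffMeans (hz : Measurable z) (hW : Measurable W) {t : Fin T} {j : Fin (k t)}
    (h : ∀ i, MemLp (fun ω => z ω i t j) 2 P) :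
    MemLp (fun ω => diffMeans (z ω) (W ω) t j) 2 P := by
  have hD : Measurable fun ω => diffMeans (z ω) (W ω) :=
    measurable_diffMeans_comp hz hW
  have hm : Measurable fun ω => diffMeans (z ω) (W ω) t j :=
    (measurable_pi_apply j).comp ((measurable_pi_apply t).comp hD)
  have hs : MemLp (fun ω => ∑ i, ‖z ω i t j‖) 2 P := memLp_finsetSum _ fun i _ => (h i).norm
  refine hs.mono hm.aestronglyMeasurable (Filter.Eventually.of_forall fun ω => ?_)
  have e : diffMeans (z ω) (W ω) t j = ∑ i, groupWeight (W ω) i * z ω i t j := by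
    rw [diffMeans_eq_sum, Finset.sum_apply, Finset.sum_apply]
    rfl
  rw [e]
  refine (norm_sum_le _ _).trans (le_trans (Finset.sum_le_sum fun i _ => ?_) (le_abs_self _))
  rw [norm_mul]
  exact mul_le_of_le_one_left (norm_nonneg _) (abs_groupWeight_le_one _ _)

/-- The joint law is the product of `n` copies of `μ` and the law of `W`, and the map acts factor by
factor. -/
theorem measurePreserving_sample [IsProbabilityMeasure P] {μ : Measure (CovVec k)}
    [IsProbabilityMeasure μ] (hz : ∀ i, Measurable fun ω => z ω i) (hW : Measurable W)
    (hlaw : ∀ i, P.map (fun ω => z ω i) = μ) (hindep : iIndepFun (fun i ω => z ω i) P)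
    (hzW : IndepFun z W P) {g : CovVec k → CovVec k} (hg : MeasurePreserving g μ μ) :
    MeasurePreserving (Prod.map (fun (y : CovMat n k) i => g (y i)) id)
      (P.map fun ω => (z ω, W ω)) (P.map fun ω => (z ω, W ω)) := by
  have hz' : Measurable z := measurable_pi_lambda _ hz
  have hzlaw : P.map z = Measure.pi fun _ : Fin n => μ := by
    have := hindep.map_fun_eq_pi_map fun i => (hz i).aemeasurable
    simpa only [hlaw] using this
  rw [hzW.map_prod_eq_prod_map_map hz'.aemeasurable hW.aemeasurable, hzlaw]
  have := Measure.isProbabilityMeasure_map (μ := P) hW.aemeasurable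
  exact (measurePreserving_pi _ _ fun _ => hg).prod (MeasurePreserving.id _)

end Sampling

/-! ### The balance criterion as an acceptance density. -/

section Criterion

variable {n T : ℕ} {k : Fin T → ℕ} {n₁ : ℕ} {φ : CovMat n k → (Fin n → Bool) → ℝ}

open Classical in
/-- The acceptance probability, extended by zero to all the assignments. -/
def acceptance (n₁ : ℕ) (φ : CovMat n k → (Fin n → Bool) → ℝ)
    (p : CovMat n k × (Fin n → Bool)) : ℝ :=
  if p.2 ∈ assignments n n₁ then φ p.1 p.2 else 0

theorem IsCriterion.measurable_acceptance (hφ : IsCriterion n₁ φ) :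
    Measurable (acceptance n₁ φ) := by
  refine measurable_from_prod_countable_left fun w => ?_
  by_cases hw : w ∈ assignments n n₁
  · simpa [acceptance, hw] using (hφ w hw).1
  · simp [acceptance, hw]

theorem IsCriterion.acceptance_nonneg (hφ : IsCriterion n₁ φ) (p : CovMat n k × (Fin n → Bool)) :
    0 ≤ acceptance n₁ φ p := by
  unfold acceptance
  split_ifs with h
  · exact ((hφ _ h).2 _).1
  · exact le_rfl

theorem IsTierwiseAffineInvariant.acceptance_tierMap (hφ : IsTierwiseAffineInvariant n₁ φ)
    (t : Fin T) {A : Matrix (Fin (k t)) (Fin (k t)) ℝ} (hA : IsUnit A)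
    (p : CovMat n k × (Fin n → Bool)) :
    acceptance n₁ φ (Prod.map (fun (y : CovMat n k) i => tierMap t A (y i)) id p)
      = acceptance n₁ φ p := by
  unfold acceptance
  simp only [Prod.map_fst, Prod.map_snd, id]
  split_ifs with h
  · rw [← affineOnTier_zero]
    exact hφ t A 0 hA _ _ h
  · rfl

theorem ae_mem_assignments {Ω : Type*} [MeasurableSpace Ω] {P : Measure Ω} {W : Ω → Fin n → Bool}
    (hW : Measurable W) (hWlaw : P.map W = uniformOn (assignments n n₁)) :
    ∀ᵐ ω ∂P, W ω ∈ assignments n n₁ := by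
  refine ae_of_ae_map hW.aemeasurable ?_
  rw [hWlaw, uniformOn]
  exact ae_cond_mem (Set.toFinite _).measurableSet

end Criterion

end Rerand

end

/-! ### The main theorem. -/

theorem theorem3 {Ω : Type*} [MeasurableSpace Ω] (P : Measure Ω) [IsProbabilityMeasure P]
    {T : ℕ} (k : Fin T → ℕ) (n n₁ : ℕ) (hn₁ : 0 < n₁) (hn₁n : n₁ < n)
    -- the super-population: an ellipsoidal law with finite second moments
    (ν : Measure (Rerand.CovVec k))
    (m : Rerand.CovIdx k → ℝ) (S : Matrix (Rerand.CovIdx k) (Rerand.CovIdx k) ℝ) (ψ : ℝ → ℂ)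
    (hν : Rerand.IsEllipsoidal (ν.map Rerand.flatten) m S ψ) (hS : S.PosDef)
    (hν2 : ∀ (t : Fin T) (j : Fin (k t)), MemLp (fun v : Rerand.CovVec k => v t j) 2 ν)
    -- the units are random samples from the super-population
    (x : Fin n → Ω → Rerand.CovVec k) (hx : ∀ i, Measurable (x i))
    (hxlaw : ∀ i, P.map (x i) = ν) (hxindep : iIndepFun x P)
    -- complete randomization, independent of the covariates
    (W : Ω → Fin n → Bool) (hW : Measurable W)
    (hWlaw : P.map W = uniformOn (Rerand.assignments n n₁))
    (hxW : IndepFun (fun ω i => x i ω) W P)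
    -- block-wise Gram-Schmidt orthogonalization
    (a : Rerand.CovVec k) (B : (s t : Fin T) → Matrix (Fin (k s)) (Fin (k t)) ℝ)
    (hGS : Rerand.IsGramSchmidt ν a B)
    (z : Ω → Rerand.CovMat n k) (hz : ∀ ω i, z ω i = Rerand.blockResidual a B (x i ω))
    -- the balance criterion
    (φ : Rerand.CovMat n k → (Fin n → Bool) → ℝ) (hφ : Rerand.IsCriterion n₁ φ)
    (hφinv : Rerand.IsTierwiseAffineInvariant n₁ φ)
    -- given covariates and assignment, acceptance is Bernoulli with success probability `φ`
    (δ : Ω → Bool) (hδ : Measurable δ)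
    (hδlaw : P⟦{ω | δ ω = true} |
        MeasurableSpace.comap (fun ω => ((fun i => x i ω), W ω)) inferInstance⟧
      =ᵐ[P] fun ω => φ (z ω) (W ω))
    (hacc : P {ω | δ ω = true} ≠ 0) :
    -- the moments below exist
    (∀ (t : Fin T) (j : Fin (k t)),
      MemLp (fun ω => Rerand.diffMeans (z ω) (W ω) t j) 2 P ∧
      MemLp (fun ω => Rerand.diffMeans (z ω) (W ω) t j) 2 (cond P {ω | δ ω = true})) ∧
    -- mean zero, given acceptance and unconditionally
    (∀ (t : Fin T) (j : Fin (k t)),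
      ∫ ω, Rerand.diffMeans (z ω) (W ω) t j ∂(cond P {ω | δ ω = true}) = 0 ∧
      ∫ ω, Rerand.diffMeans (z ω) (W ω) t j ∂P = 0) ∧
    -- different tiers are uncorrelated given acceptance
    (∀ s t : Fin T, s ≠ t → ∀ (l : Fin (k s)) (j : Fin (k t)),
      ∫ ω, Rerand.diffMeans (z ω) (W ω) s l * Rerand.diffMeans (z ω) (W ω) t j
        ∂(cond P {ω | δ ω = true}) = 0) ∧
    -- proportional covariance matrices, tier by tier
    (∀ t : Fin T, ∃ c : ℝ, 0 ≤ c ∧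
      Rerand.covMatrix (cond P {ω | δ ω = true}) (fun ω => Rerand.diffMeans (z ω) (W ω) t)
        = c • Rerand.covMatrix P (fun ω => Rerand.diffMeans (z ω) (W ω) t)) := by
  have : IsProbabilityMeasure ν := by
    rw [← hxlaw ⟨0, hn₁.trans hn₁n⟩]
    exact Measure.isProbabilityMeasure_map (hx _).aemeasurable
  have hR : Measurable (Rerand.blockResidual a B) := Rerand.measurable_blockResidual
  obtain ⟨μ, hμ⟩ : ∃ μ, μ = ν.map (Rerand.blockResidual a B) := ⟨_, rfl⟩
  have : IsProbabilityMeasure μ := hμ ▸ Measure.isProbabilityMeasure_map hR.aemeasurable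
  have hμ2 : ∀ t (j : Fin (k t)), MemLp (fun v : Rerand.CovVec k => v t j) 2 μ := fun t j => by
    have hm : Measurable fun v : Rerand.CovVec k => v t j := by fun_prop
    rw [hμ]
    exact (memLp_map_measure_iff hm.aestronglyMeasurable hR.aemeasurable).2
      (Rerand.memLp_blockResidual hν2 t j)
  -- the sample of residuals
  have hzeq : (fun i ω => z ω i) = fun i => Rerand.blockResidual a B ∘ x i := by
    ext i ω : 2
    exact hz ω i
  have hzm : ∀ i, Measurable fun ω => z ω i := fun i => by
    rw [show (fun ω => z ω i) = _ from congrFun hzeq i]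
    exact hR.comp (hx i)
  have hzm' : Measurable z := measurable_pi_lambda _ hzm
  have hzlaw : ∀ i, P.map (fun ω => z ω i) = μ := fun i => by
    rw [show (fun ω => z ω i) = _ from congrFun hzeq i, ← Measure.map_map hR (hx i), hxlaw, hμ]
  have hzindep : iIndepFun (fun i ω => z ω i) P := by
    rw [hzeq]
    exact hxindep.comp _ fun _ => hR
  have hresid : Measurable fun (y : Fin n → Rerand.CovVec k) i => Rerand.blockResidual a B (y i) :=
    measurable_pi_lambda _ fun i => hR.comp (measurable_pi_apply i)
  have hzx : z = (fun (y : Fin n → Rerand.CovVec k) i => Rerand.blockResidual a B (y i))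
      ∘ fun ω i => x i ω := by
    ext ω i : 2
    exact hz ω i
  have hzW : IndepFun z W P := by
    rw [hzx]
    exact hxW.comp hresid measurable_id
  have hη : Measurable fun ω => (z ω, W ω) := hzm'.prodMk hW
  have hD : Measurable fun ω => Rerand.diffMeans (z ω) (W ω) :=
    Rerand.measurable_diffMeans_comp hzm' hW
  -- the laws of the difference of means, unconditional and given acceptance
  have hE : MeasurableSet {ω | δ ω = true} := hδ (measurableSet_singleton true)
  obtain ⟨Q, hQ⟩ : ∃ Q, Q = cond P {ω | δ ω = true} := ⟨_, rfl⟩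
  rw [← hQ]
  have hQP : Q ≪ P := hQ ▸ cond_absolutelyContinuous
  have hxWm : Measurable fun ω => ((fun i => x i ω), W ω) :=
    (measurable_pi_lambda _ hx).prodMk hW
  have hηQ : (P.restrict {ω | δ ω = true}).map (fun ω => (z ω, W ω))
      = (P.map fun ω => (z ω, W ω)).withDensity
          fun p => ENNReal.ofReal (Rerand.acceptance n₁ φ p) := by
    refine Rerand.map_restrict_eq_withDensity hxWm.comap_le hE ?_ hφ.measurable_acceptance
      hφ.acceptance_nonneg ?_
    -- The pair `(z, W)` is a function of `(x, W)`, hence measurable for the conditioning σ-algebra.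
    · have : (fun ω => (z ω, W ω)) =
          (Prod.map (fun (y : Fin n → Rerand.CovVec k) i => Rerand.blockResidual a B (y i)) id)
            ∘ fun ω => ((fun i => x i ω), W ω) := by
        rw [hzx]
        rfl
      rw [this]
      exact (hresid.prodMap measurable_id).comp (comap_measurable _)
    · filter_upwards [hδlaw, Rerand.ae_mem_assignments hW hWlaw] with ω h1 h2
      rw [h1, Rerand.acceptance, if_pos h2]
  have hsample : ∀ (t : Fin T) (A : Matrix (Fin (k t)) (Fin (k t)) ℝ),
      (∀ h, A.mulVec h ⬝ᵥ (Rerand.tierGram μ t).mulVec (A.mulVec h)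
        = h ⬝ᵥ (Rerand.tierGram μ t).mulVec h) →
      MeasurePreserving
        (Prod.map (fun (y : Rerand.CovMat n k) i => Rerand.tierMap t A (y i)) id)
        (P.map fun ω => (z ω, W ω)) (P.map fun ω => (z ω, W ω)) := by
    intro t A hA
    refine Rerand.measurePreserving_sample hzm hW hzlaw hzindep hzW ?_
    rw [hμ] at hA ⊢
    exact hGS.measurePreserving_tierMap hν2 hν t A hA
  have htransfer : ∀ (ρ : Measure Ω) (t : Fin T) (A : Matrix (Fin (k t)) (Fin (k t)) ℝ),
      MeasurePreserving
        (Prod.map (fun (y : Rerand.CovMat n k) i => Rerand.tierMap t A (y i)) id)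
        (ρ.map fun ω => (z ω, W ω)) (ρ.map fun ω => (z ω, W ω)) →
      MeasurePreserving (Rerand.tierMap t A) (ρ.map fun ω => Rerand.diffMeans (z ω) (W ω))
        (ρ.map fun ω => Rerand.diffMeans (z ω) (W ω)) := by
    intro ρ t A h
    have hA : Measurable (Rerand.tierMap t A) :=
      (Rerand.tierMap t A).continuous_of_finiteDimensional.measurable
    refine ⟨hA, ?_⟩
    have e : ρ.map (fun ω => Rerand.diffMeans (z ω) (W ω))
        = (ρ.map fun ω => (z ω, W ω)).map fun p => Rerand.diffMeans p.1 p.2 :=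
      (Measure.map_map Rerand.measurable_diffMeans hη).symm
    rw [e, Measure.map_map hA Rerand.measurable_diffMeans]
    conv_rhs => rw [← h.map_eq, Measure.map_map Rerand.measurable_diffMeans h.measurable]
    congr 1
    ext p : 1
    exact (Rerand.diffMeans_map _ _ _).symm
  have hinvP : ∀ t, Rerand.IsTierInvariant (P.map fun ω => Rerand.diffMeans (z ω) (W ω)) t
      (Rerand.tierGram μ t) := fun t A _ hA => htransfer P t A (hsample t A hA)
  have hinvQ : ∀ t, Rerand.IsTierInvariant (Q.map fun ω => Rerand.diffMeans (z ω) (W ω)) t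
      (Rerand.tierGram μ t) := fun t A hA' hA => by
    refine htransfer Q t A ?_
    -- Up to normalization, the law given acceptance has an invariant density with respect to an
    -- invariant law.
    rw [hQ, ProbabilityTheory.cond, Measure.map_smul, hηQ]
    refine MeasurePreserving.smul_measure (Rerand.measurePreserving_withDensity (hsample t A hA)
      hφ.measurable_acceptance.ennreal_ofReal fun p => ?_) _
    rw [hφinv.acceptance_tierMap t hA']
  -- square integrability
  have hLP : ∀ (t : Fin T) (j : Fin (k t)),
      MemLp (fun ω => Rerand.diffMeans (z ω) (W ω) t j) 2 P := fun t j => by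
    refine Rerand.memLp_diffMeans hzm' hW fun i => ?_
    have := hμ2 t j
    rw [← hzlaw i] at this
    exact this.comp_of_map (hzm i).aemeasurable
  have hLQ : ∀ (t : Fin T) (j : Fin (k t)),
      MemLp (fun ω => Rerand.diffMeans (z ω) (W ω) t j) 2 Q := fun t j => by
    rw [hQ, ProbabilityTheory.cond]
    exact ((hLP t j).restrict _).smul_measure (ENNReal.inv_ne_top.2 hacc)
  have hc : ∀ t (j : Fin (k t)), Measurable fun v : Rerand.CovVec k => v t j :=
    fun t j => by fun_prop
  have hLmap : ∀ ρ : Measure Ω,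
      (∀ (t : Fin T) (j : Fin (k t)), MemLp (fun ω => Rerand.diffMeans (z ω) (W ω) t j) 2 ρ) →
      ∀ t (j : Fin (k t)), MemLp (fun v : Rerand.CovVec k => v t j) 2
        (ρ.map fun ω => Rerand.diffMeans (z ω) (W ω)) := fun ρ h t j =>
    (memLp_map_measure_iff (hc t j).aestronglyMeasurable hD.aemeasurable).2 (h t j)
  have hmean : ∀ (ρ : Measure Ω) (t : Fin T), Rerand.IsTierInvariant
      (ρ.map fun ω => Rerand.diffMeans (z ω) (W ω)) t (Rerand.tierGram μ t) →
      ∀ j : Fin (k t), ∫ ω, Rerand.diffMeans (z ω) (W ω) t j ∂ρ = 0 := fun ρ t h j => by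
    rw [← h.integral_eq_zero j, integral_map hD.aemeasurable (hc t j).aestronglyMeasurable]
  have hprod : ∀ (ρ : Measure Ω) (s t : Fin T) (l : Fin (k s)) (j : Fin (k t)),
      ∫ ω, Rerand.diffMeans (z ω) (W ω) s l * Rerand.diffMeans (z ω) (W ω) t j ∂ρ
        = ∫ v, v s l * v t j ∂(ρ.map fun ω => Rerand.diffMeans (z ω) (W ω)) := fun ρ s t l j => by
    have hm : Measurable fun v : Rerand.CovVec k => v s l * v t j := (hc s l).mul (hc t j)
    rw [integral_map hD.aemeasurable hm.aestronglyMeasurable]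
  have hcov : ∀ (ρ : Measure Ω) (t : Fin T), Rerand.IsTierInvariant
      (ρ.map fun ω => Rerand.diffMeans (z ω) (W ω)) t (Rerand.tierGram μ t) →
      Rerand.covMatrix ρ (fun ω => Rerand.diffMeans (z ω) (W ω) t)
        = Rerand.tierGram (ρ.map fun ω => Rerand.diffMeans (z ω) (W ω)) t := fun ρ t h => by
    ext l j
    simp only [Rerand.covMatrix, Rerand.tierGram, Matrix.of_apply, covariance, hmean ρ t h,
      sub_zero, hprod]
  refine ⟨fun t j => ⟨hLP t j, hLQ t j⟩, fun t j => ⟨hmean Q t (hinvQ t) j, hmean P t (hinvP t) j⟩,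
    fun s t hst l j => ?_, fun t => ?_⟩
  · rw [hprod]
    exact (hinvQ t).integral_mul_eq_zero hst l j
  rw [hcov Q t (hinvQ t), hcov P t (hinvP t)]
  have hpos : ∀ h, 0 ≤ h ⬝ᵥ (Rerand.tierGram μ t).mulVec h := fun h => by
    rw [← Rerand.integral_sq_dotProduct hμ2]
    exact integral_nonneg fun _ => sq_nonneg _
  have hQP' : (Q.map fun ω => Rerand.diffMeans (z ω) (W ω))
      ≪ P.map fun ω => Rerand.diffMeans (z ω) (W ω) := hQP.map hD
  -- A null direction of the form annihilates tier `t` of every unit almost surely, hence of the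
  -- difference of means; absolute continuity carries this over to `Q`.
  have hdeg : ∀ d, d ⬝ᵥ (Rerand.tierGram μ t).mulVec d = 0 →
      ∀ᵐ v ∂(P.map fun ω => Rerand.diffMeans (z ω) (W ω)), v t ⬝ᵥ d = 0 := by
    intro d hd
    have hm : Measurable fun v : Rerand.CovVec k => v t ⬝ᵥ d := by
      unfold dotProduct
      fun_prop
    refine (ae_map_iff (p := fun v : Rerand.CovVec k => v t ⬝ᵥ d = 0) hD.aemeasurable
      (hm (measurableSet_singleton 0))).2 ?_
    have h1 : ∀ i, ∀ᵐ ω ∂P, z ω i t ⬝ᵥ d = 0 := fun i =>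
      ae_of_ae_map (p := fun v : Rerand.CovVec k => v t ⬝ᵥ d = 0) (hzm i).aemeasurable
        (by rw [hzlaw i]; exact Rerand.ae_dotProduct_eq_zero hμ2 hd)
    filter_upwards [ae_all_iff.2 h1] with ω hω
    rw [Rerand.diffMeans_eq_sum, Finset.sum_apply, sum_dotProduct]
    refine Finset.sum_eq_zero fun i _ => ?_
    rw [Pi.smul_apply, smul_dotProduct, hω, smul_zero]
  obtain ⟨c₁, hc₁, e₁⟩ := (hinvP t).exists_tierGram_eq_smul (hLmap P hLP)
    (Rerand.tierGram_transpose μ t) hpos hdeg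
  obtain ⟨c₂, hc₂, e₂⟩ := (hinvQ t).exists_tierGram_eq_smul (hLmap Q hLQ)
    (Rerand.tierGram_transpose μ t) hpos fun d hd => hQP'.ae_le (hdeg d hd)
  -- If `c₁ = 0` the quotient `c₂ / c₁` is of no use, but then tier `t` of the difference of means
  -- vanishes almost surely under `P`, hence under `Q`, and both covariances are zero.
  rcases eq_or_ne c₁ 0 with h0 | h0
  · refine ⟨0, le_rfl, ?_⟩
    rw [zero_smul]
    refine Rerand.matrix_eq_of_forall_dotProduct_mulVec (Rerand.tierGram_transpose _ t)
      Matrix.transpose_zero fun h => ?_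
    have hae := hQP'.ae_le (Rerand.ae_dotProduct_eq_zero (hLmap P hLP) (t := t) (h := h)
      (by rw [e₁, h0, zero_smul, Matrix.zero_mulVec, dotProduct_zero]))
    rw [← Rerand.integral_sq_dotProduct (hLmap Q hLQ), Matrix.zero_mulVec, dotProduct_zero]
    refine integral_eq_zero_of_ae ?_
    filter_upwards [hae] with v hv
    simp [hv]
  · refine ⟨c₂ / c₁, div_nonneg hc₂ hc₁, ?_⟩
    rw [e₁, e₂, smul_smul, div_mul_cancel₀ _ h0]
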